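/- **Theorem (Upper bound on the SOC).** Fix a path loss exponent $\alpha>2$, put $\delta=2/\alpha\in(0,1)$, and let $\theta>0$ and $\epsilon\in(0,1)$. For $\lambda>0$ and $p\in(0,1]$ consider the Poisson bipolar network with ALOHA and unit link distance, seen from the receiver of the typical link: a receiver at the origin, its transmitter at distance $1$, which is active, and potential interferers forming a homogeneous Poisson point process $\Phi\subset\mathbb{R}^2$ of density $\lambda$, each of them active independently with probability $p$. All active transmitters use unit power, the path loss is $\|x\|^{-\alpha}$, and the channel power gains $h$ (of the desired link) and $h_x$ ($x\in\Phi$) are independent exponential random variables of mean $1$; $\Phi$, the activities and the gains are independent. Let $$\mathsf{SIR}=\frac{h}{\sum_{x\in\Phi,\ x\text{ active}}h_x\|x\|^{-\alpha}},\qquad P_{\rm s}(\theta)=\mathbb{P}(\mathsf{SIR}>\theta\mid\Phi),\qquad \eta(\theta,\epsilon)=\mathbb{P}\big(P_{\rm s}(\theta)>1-\epsilon\big),$$ and let the spatial outage capacity be $$S(\theta,\epsilon)=\sup_{\lambda>0,\ 0<p\le1}\lambda\,p\,\eta(\theta,\epsilon).$$ Then, for every $b>0$, $$S(\theta,\epsilon)\le\begin{cases}\dfrac{1}{e\pi\theta^{\delta}\,\Gamma(1-\delta)\,\Gamma(1+\delta)}\cdot\dfrac{1}{b(1-\epsilon)^{b}},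 & 0<b\le1,\\[2ex] \dfrac{1}{e\pi\theta^{\delta}\,\Gamma(1-\delta)}\cdot\dfrac{\Gamma(b)}{\Gamma(b+\delta)\,(1-\epsilon)^{b}}, & b>1.\end{cases}$$ -/

import Mathlib

open MeasureTheory ProbabilityTheory
open scoped ENNReal NNReal

/-- The Euclidean plane. -/
abbrev Plane : Type := EuclideanSpace ℝ (Fin 2)

/-- The random counting measure `Φ = ∑ᵢ δ_{Xᵢ}` of an enumerated point process; `Φ(A)` is the
number of points in `A`. -/
noncomputable def countingMeasure {Ω : Type*} (X : ℕ → Ω → Plane) (ω : Ω) : Measure Plane :=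
  Measure.sum fun i => Measure.dirac (X i ω)

/-- `X` enumerates the points of a homogeneous Poisson point process of density `lam` on the plane:
the number of points in a Borel set `A` of finite area is Poisson distributed with mean
`lam * area A`, and the numbers of points in finitely many disjoint Borel sets are independent.
(For `lam > 0` there are almost surely infinitely many points, so `ℕ` is the right index set.) -/
structure IsPoissonPointProcess {Ω : Type*} [MeasurableSpace Ω] (P : Measure Ω)
    (X : ℕ → Ω → Plane) (lam : ℝ) : Prop where
  measurable_points : ∀ i, Measurable (X i)
  map_count : ∀ A : Set Plane, MeasurableSet A → volume A ≠ ∞ →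
    P.map (fun ω => countingMeasure X ω A) =
      (poissonMeasure (lam.toNNReal * (volume A).toNNReal)).map (fun n : ℕ => (n : ℝ≥0∞))
  indep_count : ∀ (n : ℕ) (A : Fin n → Set Plane), (∀ j, MeasurableSet (A j)) →
    Pairwise (fun j k => Disjoint (A j) (A k)) →
    iIndepFun (fun j ω => countingMeasure X ω (A j)) P

/-- A Poisson bipolar network with ALOHA and Rayleigh fading, seen from the receiver of the typical
link (at the origin): the potential interferers form a Poisson point process of density `lam`,
each is active independently with probability `p`, and all channel power gains are independent
exponential variables of mean `1`. The gain with index `none` belongs to the desired transmitter,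
the gain with index `some i` to the `i`-th potential interferer. The desired transmitter is added
to the Poisson process and is active. -/
structure PoissonBipolarNetwork (lam p : ℝ) where
  Ω : Type*
  [mΩ : MeasurableSpace Ω]
  P : Measure Ω
  [isProbabilityMeasure : IsProbabilityMeasure P]
  point : ℕ → Ω → Plane
  active : ℕ → Ω → Bool
  gain : Option ℕ → Ω → ℝ
  isPoisson : IsPoissonPointProcess P point lam
  measurable_active : ∀ i, Measurable (active i)
  prob_active : ∀ i, P {ω | active i ω = true} = ENNReal.ofReal p
  indep_active : iIndepFun active P
  measurable_gain : ∀ j, Measurable (gain j)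
  map_gain : ∀ j, P.map (gain j) = expMeasure 1
  indep_gain : iIndepFun gain P
  indep_active_gain : IndepFun (fun ω i => active i ω) (fun ω j => gain j ω) P
  indep_point_marks : IndepFun (fun ω i => point i ω)
    (fun ω => ((fun i => active i ω), (fun j => gain j ω))) P

namespace PoissonBipolarNetwork

attribute [instance] mΩ isProbabilityMeasure

variable {lam p : ℝ} (N : PoissonBipolarNetwork lam p)

/-- Total power received at the origin from the active interferers, with path loss `‖x‖ ^ (-α)`. -/
noncomputable def interference (α : ℝ) (ω : N.Ω) : ℝ≥0∞ :=
  ∑' i, if N.active i ω = true then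
    ENNReal.ofReal (N.gain (some i) ω) * ENNReal.ofReal ‖N.point i ω‖ ^ (-α) else 0

/-- Signal-to-interference ratio at the origin, the desired transmitter being at distance `R`. -/
noncomputable def sir (R α : ℝ) (ω : N.Ω) : ℝ≥0∞ :=
  ENNReal.ofReal (N.gain none ω) * ENNReal.ofReal R ^ (-α) / N.interference α ω

/-- The σ-algebra generated by the point process `Φ`. -/
noncomputable abbrev pointSigma : MeasurableSpace N.Ω :=
  MeasurableSpace.comap (countingMeasure N.point) inferInstance

/-- Conditional link success probability `P(SIR > θ ∣ Φ)`. -/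
noncomputable def linkSuccess (R α θ : ℝ) : N.Ω → ℝ :=
  N.P⟦{ω | ENNReal.ofReal θ < N.sir R α ω} | N.pointSigma⟧

/-- Meta distribution of the SIR: the probability that the conditional link success probability
exceeds `1 - ε`. -/
noncomputable def eta (R α θ ε : ℝ) : ℝ≥0∞ :=
  N.P {ω | 1 - ε < N.linkSuccess R α θ ω}

end PoissonBipolarNetwork

/-- Spatial outage capacity: the supremum of `lam * p * η` over `lam > 0` and `0 < p ≤ 1`, where
`N lam p` is the network with these parameters. It is taken in `[0, ∞]`. -/
noncomputable def spatialOutageCapacity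
    (N : ∀ lam p : ℝ, 0 < lam → 0 < p → p ≤ 1 → PoissonBipolarNetwork lam p)
    (R α θ ε : ℝ) : ℝ≥0∞ :=
  ⨆ (lam : ℝ) (p : ℝ) (hlam : 0 < lam) (hp : 0 < p) (hp1 : p ≤ 1),
    ENNReal.ofReal (lam * p) * (N lam p hlam hp hp1).eta R α θ ε

/-!
Let `w(t) = 1 / (1 + θ t ^ (-1/δ))` be the probability that the desired exponential gain beats `θ`
times the power of one active interferer at squared distance `t` (`fadeLaplace`). Given the point
process, the gains are exponential and the marks independent, so the link success probability is
at most the product, over any finite set of points, of the factors `1 - p + p w(‖x‖²)`.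

The factor increases with the distance. Cutting a disc of the plane into finitely many annuli and
replacing every point by one on the outer rim of its annulus gives a bound `∏ⱼ zⱼ ^ Φ(Aⱼ)` that
depends only on finitely many counts (`linkSuccess_ae_le`). It is measurable with respect to `Φ`,
and its moments are products of Poisson generating functions (`lintegral_regionProduct`). With
Markov's inequality for the `b`-th moment this yields `eta_le_exp`:
`η ≤ exp (-λ ∑ⱼ |Aⱼ| (1 - zⱼ ^ b)) / (1 - ε) ^ b`.

Since `1 - (1 - p + p w) ^ b ≥ p f` with `f = b (1 - w)` for `b ≤ 1` (Bernoulli) and `f = 1 - w ^ b`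
for `b > 1` (convexity), the exponent is at most `-λ p K` for a lower Riemann sum `K` of `π ∫ f`,
and `x exp (-x K) ≤ 1 / (e K)` removes both `λ` and `p`. Refining the annuli, `K` tends to `π ∫ f`
(`mul_eta_le`), and a layer-cake computation reduces `∫ f` to a Beta integral
(`lintegral_one_sub_fadeLaplace_rpow`). In particular neither the full Laplace functional of the
Poisson process nor an exact formula for the conditional success probability is needed.
-/

/-! ### The Laplace transform of a faded interferer and its Beta integral -/

/-- The Laplace transform at `θ` of the power `h t ^ (-1/δ)` received from an interferer at squared
distance `t`, where `h` is exponential of mean `1` and `δ = 2 / α`, so that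
`t ^ (-1/δ) = ‖x‖ ^ (-α)` for `t = ‖x‖ ^ 2`. Only `t > 0` matters. -/
noncomputable def fadeLaplace (δ θ t : ℝ) : ℝ := (1 + θ * t ^ (-(1 / δ)))⁻¹

section FadeLaplace

variable {δ θ : ℝ}

lemma fadeLaplace_pos (hθ : 0 < θ) {t : ℝ} (ht : 0 < t) : 0 < fadeLaplace δ θ t := by
  unfold fadeLaplace; positivity

lemma fadeLaplace_lt_one (hθ : 0 < θ) {t : ℝ} (ht : 0 < t) : fadeLaplace δ θ t < 1 := by
  unfold fadeLaplace
  apply inv_lt_one_of_one_lt₀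
  have : 0 < θ * t ^ (-(1 / δ)) := by positivity
  linarith

lemma measurable_fadeLaplace : Measurable (fadeLaplace δ θ) := by
  unfold fadeLaplace; fun_prop

lemma fadeLaplace_monotoneOn (hδ : 0 < δ) (hθ : 0 < θ) :
    MonotoneOn (fadeLaplace δ θ) (Set.Ioi 0) := by
  intro s hs t ht hst
  have hs : 0 < s := hs
  have ht : 0 < t := ht
  unfold fadeLaplace
  have := Real.rpow_le_rpow_of_nonpos hs hst (z := -(1 / δ)) (by simp; positivity)
  gcongr

lemma fadeLaplace_lt_iff (hδ : 0 < δ) (hθ : 0 < θ) {t x : ℝ} (ht : 0 < t) (hx0 : 0 < x)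
    (hx1 : x < 1) :
    fadeLaplace δ θ t < x ↔ t < θ ^ δ * x ^ δ * (1 - x) ^ (-δ) := by
  have h1x : 0 < 1 - x := by linarith
  have e : θ ^ δ * x ^ δ * (1 - x) ^ (-δ) = (θ * x / (1 - x)) ^ δ := by
    rw [Real.div_rpow (by positivity) h1x.le, Real.mul_rpow hθ.le hx0.le, Real.rpow_neg h1x.le]
    rfl
  rw [e, ← inv_inv δ, Real.lt_rpow_inv_iff_of_pos ht.le (by positivity) (inv_pos.2 hδ), inv_inv]
  unfold fadeLaplace
  have hT : 0 < t ^ (δ⁻¹) := by positivity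
  rw [Real.rpow_neg ht.le, one_div, inv_lt_iff_one_lt_mul₀ (by positivity), lt_div_iff₀ h1x]
  rw [show x * (1 + θ * (t ^ δ⁻¹)⁻¹) = (x * t ^ δ⁻¹ + θ * x) / t ^ δ⁻¹ by field_simp,
    lt_div_iff₀ hT]
  constructor <;> intro h <;> linarith

/-- By the layer-cake formula and Tonelli, the integral of `1 - w ^ b` equals that of
`b * x ^ (b - 1) * |{t > 0 : w(t) < x}|` over `0 < x < 1`, and the measure of the set is
`θ ^ δ * x ^ δ * (1 - x) ^ (-δ)`; the outcome is a Beta integral. -/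
lemma lintegral_one_sub_fadeLaplace_rpow (hδ0 : 0 < δ) (hδ1 : δ < 1) (hθ : 0 < θ) {b : ℝ}
    (hb : 0 < b) :
    ∫⁻ t in Set.Ioi 0, ENNReal.ofReal (1 - fadeLaplace δ θ t ^ b) =
      ENNReal.ofReal (θ ^ δ * Real.Gamma (1 - δ) * Real.Gamma (b + δ) / Real.Gamma b) := by
  have hw := measurable_fadeLaplace (δ := δ) (θ := θ)
  -- the layer-cake formula `1 - w ^ b = ∫ x in w..1, b * x ^ (b - 1)`
  have h1 : ∀ t ∈ Set.Ioi (0 : ℝ), ENNReal.ofReal (1 - fadeLaplace δ θ t ^ b) =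
      ∫⁻ x in Set.Ioo (0 : ℝ) 1, {q : ℝ × ℝ | fadeLaplace δ θ q.1 < q.2}.indicator
        (fun q => ENNReal.ofReal (b * q.2 ^ (b - 1))) (t, x) := by
    intro t ht
    have hw0 := fadeLaplace_pos (δ := δ) hθ ht
    have hw1 := fadeLaplace_lt_one (δ := δ) hθ ht
    have : ∀ x, {q : ℝ × ℝ | fadeLaplace δ θ q.1 < q.2}.indicator
        (fun q => ENNReal.ofReal (b * q.2 ^ (b - 1))) (t, x) =
        (Set.Ioi (fadeLaplace δ θ t)).indicator (fun x => ENNReal.ofReal (b * x ^ (b - 1))) x := by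
      intro x; simp [Set.indicator]
    simp_rw [this]
    rw [setLIntegral_indicator measurableSet_Ioi]
    have hI : Set.Ioi (fadeLaplace δ θ t) ∩ Set.Ioo 0 1 = Set.Ioo (fadeLaplace δ θ t) 1 := by
      ext x; simp only [Set.mem_inter_iff, Set.mem_Ioi, Set.mem_Ioo]
      exact ⟨fun h => ⟨h.1, h.2.2⟩, fun h => ⟨h.1, hw0.trans h.1, h.2⟩⟩
    rw [hI, ← setLIntegral_congr Ioo_ae_eq_Ioc.symm, ← ofReal_integral_eq_lintegral_ofReal,
      ← intervalIntegral.integral_of_le hw1.le, intervalIntegral.integral_const_mul, integral_rpow]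
    · simp only [sub_add_cancel, Real.one_rpow]
      congr 1; field_simp
    · left; linarith
    · rw [← IntegrableOn, ← intervalIntegrable_iff_integrableOn_Ioc_of_le hw1.le]
      exact (intervalIntegral.intervalIntegrable_rpow' (by linarith)).const_mul _
    · refine (ae_restrict_iff' measurableSet_Ioc).2 (.of_forall fun x hx => ?_)
      have : 0 < x := hw0.trans hx.1
      simp only [Pi.zero_apply]; positivity
  rw [setLIntegral_congr_fun measurableSet_Ioi h1, lintegral_lintegral_swap]
  swap
  · refine Measurable.aemeasurable ?_
    change Measurable fun q : ℝ × ℝ => _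
    refine Measurable.indicator (f := fun q : ℝ × ℝ => ENNReal.ofReal (b * q.2 ^ (b - 1)))
      (by fun_prop) ?_
    exact measurableSet_lt (hw.comp measurable_fst) measurable_snd
  have hB : 0 < beta (b + δ) (1 - δ) := beta_pos (by linarith) (by linarith)
  have h2 : ∀ x ∈ Set.Ioo (0 : ℝ) 1,
      ∫⁻ t in Set.Ioi 0, {q : ℝ × ℝ | fadeLaplace δ θ q.1 < q.2}.indicator
        (fun q => ENNReal.ofReal (b * q.2 ^ (b - 1))) (t, x) =
      ENNReal.ofReal (b * θ ^ δ * beta (b + δ) (1 - δ)) *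
        ENNReal.ofReal (1 / beta (b + δ) (1 - δ) * x ^ (b + δ - 1) * (1 - x) ^ (1 - δ - 1)) := by
    intro x hx
    have h1x : 0 < 1 - x := by linarith [hx.2]
    have hx0 := hx.1
    have : ∀ t ∈ Set.Ioi (0 : ℝ), {q : ℝ × ℝ | fadeLaplace δ θ q.1 < q.2}.indicator
        (fun q => ENNReal.ofReal (b * q.2 ^ (b - 1))) (t, x) =
        (Set.Iio (θ ^ δ * x ^ δ * (1 - x) ^ (-δ))).indicator
          (fun _ => ENNReal.ofReal (b * x ^ (b - 1))) t := by
      intro t ht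
      simp only [Set.indicator, Set.mem_ofPred_eq, Set.mem_Iio,
        fadeLaplace_lt_iff hδ0 hθ ht hx.1 hx.2]
    rw [setLIntegral_congr_fun measurableSet_Ioi this, setLIntegral_indicator measurableSet_Iio,
      setLIntegral_const, Set.inter_comm, Set.Ioi_inter_Iio, Real.volume_Ioo, sub_zero,
      ← ENNReal.ofReal_mul (by positivity), ← ENNReal.ofReal_mul (by positivity)]
    congr 1
    rw [show b + δ - 1 = (b - 1) + δ by ring, Real.rpow_add hx0, show 1 - δ - 1 = -δ by ring]
    field_simp
  rw [setLIntegral_congr_fun measurableSet_Ioo h2, lintegral_const_mul _ (by fun_prop),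
    ← lintegral_betaPDF, lintegral_betaPDF_eq_one (by linarith) (by linarith), mul_one, beta,
    show b + δ + (1 - δ) = b + 1 by ring, Real.Gamma_add_one hb.ne']
  congr 1
  have := (Real.Gamma_pos_of_pos hb).ne'
  field_simp

lemma integral_one_sub_fadeLaplace_rpow (hδ0 : 0 < δ) (hδ1 : δ < 1) (hθ : 0 < θ) {b : ℝ}
    (hb : 0 < b) :
    IntegrableOn (fun t => 1 - fadeLaplace δ θ t ^ b) (Set.Ioi 0) ∧
    ∫ t in Set.Ioi 0, (1 - fadeLaplace δ θ t ^ b) =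
      θ ^ δ * Real.Gamma (1 - δ) * Real.Gamma (b + δ) / Real.Gamma b := by
  have hw := measurable_fadeLaplace (δ := δ) (θ := θ)
  have hm : Measurable fun t => 1 - fadeLaplace δ θ t ^ b := by fun_prop
  have h := lintegral_one_sub_fadeLaplace_rpow hδ0 hδ1 hθ hb
  have h0 : 0 ≤ᵐ[volume.restrict (Set.Ioi 0)] fun t => 1 - fadeLaplace δ θ t ^ b := by
    refine (ae_restrict_iff' measurableSet_Ioi).2 (.of_forall fun t ht => ?_)
    exact sub_nonneg.2 (Real.rpow_le_one (fadeLaplace_pos hθ ht).le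
      (fadeLaplace_lt_one hθ ht).le hb.le)
  refine ⟨(lintegral_ofReal_ne_top_iff_integrable hm.aestronglyMeasurable h0).1
    (by rw [h]; exact ENNReal.ofReal_ne_top), ?_⟩
  rw [integral_eq_lintegral_of_nonneg_ae h0 hm.aestronglyMeasurable, h, ENNReal.toReal_ofReal]
  have := Real.Gamma_pos_of_pos hb
  have := Real.Gamma_pos_of_pos (show 0 < 1 - δ by linarith)
  have := Real.Gamma_pos_of_pos (show 0 < b + δ by linarith)
  positivity

end FadeLaplace

/-! ### Riemann sums of decreasing functions on the half-line -/

/-- The sum with right end points and mesh `1 / m` over `m ^ 2` cells starting at `0`, compared with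
the integral over the same window shifted by one cell. The shift keeps the interval away from `0`,
where the function need not be controlled. -/
lemma AntitoneOn.integral_le_riemann_sum {f : ℝ → ℝ} (hf : AntitoneOn f (Set.Ioi 0)) {m : ℕ}
    (hm : 0 < m) :
    ∫ t in (1 / m : ℝ)..(1 / m + m), f t ≤
      ∑ i ∈ Finset.range (m ^ 2), (1 / m : ℝ) * f ((i + 1) / m) := by
  have hm' : (0 : ℝ) < m := by exact_mod_cast hm
  have h : AntitoneOn (fun x => f (x / m)) (Set.Icc 1 (1 + (m ^ 2 : ℕ))) := by
    intro x hx y hy hxy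
    have hx0 : 0 < x := by linarith [hx.1]
    exact hf (div_pos hx0 hm') (div_pos (hx0.trans_le hxy) hm') (by gcongr)
  have h2 := h.integral_le_sum
  rw [intervalIntegral.integral_comp_div _ hm'.ne'] at h2
  have e : ((1 : ℝ) + (m ^ 2 : ℕ)) / m = 1 / m + m := by push_cast; field_simp
  rw [e, smul_eq_mul] at h2
  rw [← Finset.mul_sum, one_div, inv_mul_eq_div, le_div_iff₀ hm', mul_comm]
  rw [one_div] at h2
  simpa [add_comm] using h2

lemma tendsto_intervalIntegral_riemann_window {f : ℝ → ℝ} (hf : IntegrableOn f (Set.Ioi 0)) :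
    Filter.Tendsto (fun n : ℕ => ∫ t in (1 / (n + 1 : ℕ) : ℝ)..(1 / (n + 1 : ℕ) + (n + 1 : ℕ)), f t)
      Filter.atTop (nhds (∫ t in Set.Ioi 0, f t)) := by
  have h0 : Filter.Tendsto (fun n : ℕ => (1 / (n + 1 : ℕ) : ℝ)) Filter.atTop (nhds 0) := by
    simpa using tendsto_one_div_add_atTop_nhds_zero_nat (𝕜 := ℝ)
  have h1 : Filter.Tendsto (fun n : ℕ => (1 / (n + 1 : ℕ) + (n + 1 : ℕ) : ℝ)) Filter.atTop
      Filter.atTop := by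
    refine Filter.tendsto_atTop_mono (fun n => ?_) tendsto_natCast_atTop_atTop
    have : (0 : ℝ) < 1 / (n + 1 : ℕ) := by positivity
    push_cast at *
    linarith
  have hc : AECover (volume.restrict (Set.Ioi (0 : ℝ))) Filter.atTop
      fun n : ℕ => Set.Ioc (1 / (n + 1 : ℕ) : ℝ) (1 / (n + 1 : ℕ) + (n + 1 : ℕ)) := by
    refine ⟨?_, fun n => measurableSet_Ioc⟩
    refine (ae_restrict_iff' measurableSet_Ioi).2 (.of_forall fun x hx => ?_)
    filter_upwards [h0.eventually_lt_const hx, h1.eventually_ge_atTop x] with n a b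
    exact ⟨a, b⟩
  have := hc.integral_tendsto_of_countably_generated hf
  refine this.congr fun n => ?_
  rw [intervalIntegral.integral_of_le (by simp; positivity), Measure.restrict_restrict measurableSet_Ioc,
    Set.inter_eq_left.2]
  intro x hx
  exact lt_of_le_of_lt (by positivity) hx.1

/-! ### Success probability for fixed points -/

lemma ProbabilityTheory.IndepFun.measure_mem_eq_lintegral {Ω β γ : Type*} [MeasurableSpace Ω] [MeasurableSpace β]
    [MeasurableSpace γ] {P : Measure Ω} [IsProbabilityMeasure P] {X : Ω → β} {Y : Ω → γ}
    (h : IndepFun X Y P) (hX : Measurable X) (hY : Measurable Y) {S : Set (β × γ)}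
    (hS : MeasurableSet S) :
    P {ω | (X ω, Y ω) ∈ S} = ∫⁻ ω, P {ω' | (X ω, Y ω') ∈ S} ∂P := by
  have := Measure.isProbabilityMeasure_map (μ := P) hY.aemeasurable
  have h1 : P {ω | (X ω, Y ω) ∈ S} = P.map (fun ω => (X ω, Y ω)) S :=
    (Measure.map_apply (hX.prodMk hY) hS).symm
  rw [h1, h.map_prod_eq_prod_map_map hX.aemeasurable hY.aemeasurable, Measure.prod_apply hS,
    lintegral_map (measurable_measure_prodMk_left hS) hX]
  refine lintegral_congr fun ω => ?_
  rw [Measure.map_apply hY (measurable_prodMk_left hS)]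
  rfl

lemma expMeasure_one_Ioi {y : ℝ} (hy : 0 ≤ y) :
    expMeasure 1 (Set.Ioi y) = ENNReal.ofReal (Real.exp (-y)) := by
  have := isProbabilityMeasure_expMeasure one_pos
  have h := cdf_expMeasure_eq one_pos y
  rw [if_pos hy, cdf_eq_real] at h
  have h2 := probReal_compl_eq_one_sub (μ := expMeasure 1) (measurableSet_Iic (a := y))
  rw [h, Set.compl_Iic] at h2
  rw [← ofReal_measureReal, h2]
  simp

/-- The Laplace transform of the exponential law. The truncation `max x 0` only alters a null set;
it matches the `ENNReal.ofReal` applied to the gains. -/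
lemma lintegral_exp_neg_mul_expMeasure_one {d : ℝ} (hd : 0 ≤ d) :
    ∫⁻ x, ENNReal.ofReal (Real.exp (-(d * max x 0))) ∂(expMeasure 1) =
      ENNReal.ofReal (1 + d)⁻¹ := by
  have h : ∀ x, exponentialPDF 1 x * ENNReal.ofReal (Real.exp (-(d * max x 0))) =
      ENNReal.ofReal (1 + d)⁻¹ * exponentialPDF (1 + d) x := by
    intro x
    rcases lt_or_ge x 0 with hx | hx
    · simp [exponentialPDF_of_neg hx]
    · rw [exponentialPDF_of_nonneg hx, exponentialPDF_of_nonneg hx, max_eq_left hx,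
        ← ENNReal.ofReal_mul (by positivity), ← ENNReal.ofReal_mul (by positivity)]
      congr 1
      rw [one_mul, ← Real.exp_add]
      field_simp
      ring_nf
  have hm : Measurable (exponentialPDF 1) := by unfold exponentialPDF; fun_prop
  have hm' : Measurable (exponentialPDF (1 + d)) := by unfold exponentialPDF; fun_prop
  change ∫⁻ x, _ ∂(volume.withDensity (exponentialPDF 1)) = _
  rw [lintegral_withDensity_eq_lintegral_mul _ hm (by fun_prop)]
  simp only [Pi.mul_apply, h]
  rw [lintegral_const_mul _ hm', lintegral_exponentialPDF_eq_one (by linarith), mul_one]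

/-- Rayleigh fading: an exponential variable exceeds an independent `Y ≥ 0` with probability
`E[exp (-Y)]`, which factorizes when `Y` is a weighted sum of independent gains. -/
lemma measure_weighted_gain_sum_lt_le {Ω ι : Type*} [MeasurableSpace Ω] {P : Measure Ω}
    [IsProbabilityMeasure P] {G : ι → Ω → ℝ} (hG : ∀ i, Measurable (G i))
    (hlaw : ∀ i, P.map (G i) = expMeasure 1) (hind : iIndepFun G P) {s : Finset ι} {j : ι}
    (hj : j ∉ s) {d : ι → ℝ} (hd : ∀ i, 0 ≤ d i) :
    P {ω | ∑ i ∈ s, d i * max (G i ω) 0 < G j ω} ≤ ∏ i ∈ s, ENNReal.ofReal (1 + d i)⁻¹ := by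
  classical
  -- one independent family containing both the gain `j` and the summands
  let g : ι → ℝ → ℝ := fun i x => if i = j then x else d i * max x 0
  have hg : ∀ i, Measurable (g i) := by
    intro i; by_cases h : i = j <;> simp only [g, h, if_true, if_false] <;> fun_prop
  have hf := hind.comp g hg
  have hfm : ∀ i, Measurable (g i ∘ G i) := fun i => (hg i).comp (hG i)
  have hfs : ∀ i ∈ s, ∀ ω, (g i ∘ G i) ω = d i * max (G i ω) 0 := by
    intro i hi ω
    have : i ≠ j := fun h => hj (h ▸ hi)
    simp [g, this]
  have hfj : g j ∘ G j = G j := by ext; simp [g]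
  have hY := hf.indepFun_finsetSum_of_notMem hfm hj
  rw [hfj] at hY
  have hYe : ∀ ω, (∑ i ∈ s, g i ∘ G i) ω = ∑ i ∈ s, d i * max (G i ω) 0 := by
    intro ω; rw [Finset.sum_apply]; exact Finset.sum_congr rfl fun i hi => hfs i hi ω
  have hYm : Measurable (∑ i ∈ s, g i ∘ G i) := by
    rw [Finset.sum_fn]
    exact Finset.measurable_sum s fun i _ => hfm i
  have key := hY.measure_mem_eq_lintegral hYm (hG j)
    (measurableSet_lt measurable_fst measurable_snd)
  simp only [Set.mem_ofPred_eq, hYe] at key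
  rw [key]
  have h1 : ∀ ω, P {ω' | ∑ i ∈ s, d i * max (G i ω) 0 < G j ω'} =
      ∏ i ∈ s, ENNReal.ofReal (Real.exp (-(d i * max (G i ω) 0))) := by
    intro ω
    have := Measure.map_apply (μ := P) (hG j) (measurableSet_Ioi (a := ∑ i ∈ s, d i * max (G i ω) 0))
    rw [hlaw, expMeasure_one_Ioi (Finset.sum_nonneg fun i _ => mul_nonneg (hd i) (le_max_right _ _))]
      at this
    rw [← ENNReal.ofReal_prod_of_nonneg fun i _ => (Real.exp_pos _).le, ← Real.exp_sum,
      Finset.sum_neg_distrib]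
    exact this.symm
  simp_rw [h1]
  have hmE : ∀ i, Measurable fun x : ℝ => ENNReal.ofReal (Real.exp (-(d i * max x 0))) :=
    fun i => by fun_prop
  have h2 := lintegral_prod_eq_prod_lintegral_of_indepFun s
    (fun i ω => ENNReal.ofReal (Real.exp (-(d i * max (G i ω) 0)))) (hind.comp _ hmE)
    (fun i => (hmE i).comp (hG i))
  rw [h2]
  refine (Finset.prod_congr rfl fun i _ => ?_).le
  rw [← lintegral_exp_neg_mul_expMeasure_one (hd i), ← hlaw i, lintegral_map (hmE i) (hG i)]

namespace PoissonBipolarNetwork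

variable {lam p : ℝ} (N : PoissonBipolarNetwork lam p)

/-- The bound of `measure_weighted_gain_sum_lt_le` applied for fixed activities and then averaged
over the independent activities. -/
lemma measure_active_gain_sum_lt_le (hp0 : 0 < p) (hp1 : p ≤ 1) (s : Finset ℕ) {c : ℕ → ℝ}
    (hc : ∀ i, 0 ≤ c i) :
    N.P {ω | ∑ i ∈ s, (if N.active i ω = true then c i * max (N.gain (some i) ω) 0 else 0) <
      N.gain none ω} ≤ ∏ i ∈ s, ENNReal.ofReal (1 - p + p * (1 + c i)⁻¹) := by
  have hA : Measurable fun ω i => N.active i ω := measurable_pi_lambda _ N.measurable_active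
  have hG : Measurable fun ω j => N.gain j ω := measurable_pi_lambda _ N.measurable_gain
  have hS : MeasurableSet {q : (ℕ → Bool) × (Option ℕ → ℝ) |
      ∑ i ∈ s, (if q.1 i = true then c i * max (q.2 (some i)) 0 else 0) < q.2 none} := by
    refine measurableSet_lt (Finset.measurable_sum s fun i _ => ?_) (by fun_prop)
    refine Measurable.ite ?_ (by fun_prop) measurable_const
    exact measurableSet_eq_fun (by fun_prop) measurable_const
  have key := N.indep_active_gain.measure_mem_eq_lintegral hA hG hS
  simp only [Set.mem_ofPred_eq] at key
  rw [key]
  have h1 : ∀ ω, N.P {ω' | ∑ i ∈ s, (if N.active i ω = true then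
      c i * max (N.gain (some i) ω') 0 else 0) < N.gain none ω'} ≤
      ∏ i ∈ s, (if N.active i ω = true then ENNReal.ofReal (1 + c i)⁻¹ else 1) := by
    intro ω
    let d : Option ℕ → ℝ := fun o => o.elim 0 fun i => if N.active i ω = true then c i else 0
    have h := measure_weighted_gain_sum_lt_le N.measurable_gain N.map_gain N.indep_gain
      (s := s.map Function.Embedding.some) (j := none) (by simp) (d := d) (by
        rintro (_ | i)
        · exact le_rfl
        · simp only [d, Option.elim]; split_ifs
          exacts [hc i, le_rfl])
    simp only [Finset.sum_map, Finset.prod_map, Function.Embedding.some_apply, d, Option.elim] at h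
    refine le_trans (le_of_eq ?_) (h.trans (le_of_eq ?_))
    · congr 1; ext ω'; simp only [Set.mem_ofPred_eq, ite_mul, zero_mul]
    · refine Finset.prod_congr rfl fun i _ => ?_
      split_ifs <;> simp
  refine (lintegral_mono h1).trans (le_of_eq ?_)
  have hmB : ∀ i, Measurable fun a : Bool =>
      if a = true then ENNReal.ofReal (1 + c i)⁻¹ else 1 := fun i => measurable_of_countable _
  have h2 := lintegral_prod_eq_prod_lintegral_of_indepFun s
    (fun i ω => if N.active i ω = true then ENNReal.ofReal (1 + c i)⁻¹ else 1)
    (N.indep_active.comp _ hmB) (fun i => (hmB i).comp (N.measurable_active i))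
  rw [h2]
  refine Finset.prod_congr rfl fun i _ => ?_
  have hm : MeasurableSet {ω | N.active i ω = true} :=
    measurableSet_eq_fun (N.measurable_active i) measurable_const
  have h3 : N.P {ω | N.active i ω = true}ᶜ = ENNReal.ofReal (1 - p) := by
    rw [prob_compl_eq_one_sub hm, N.prob_active, ENNReal.ofReal_sub _ hp0.le, ENNReal.ofReal_one]
  have hci := hc i
  let f : N.Ω → ℝ≥0∞ := fun ω => if N.active i ω = true then ENNReal.ofReal (1 + c i)⁻¹ else 1
  have e1 : Set.EqOn f (fun _ => ENNReal.ofReal (1 + c i)⁻¹) {ω | N.active i ω = true} :=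
    fun ω hω => if_pos hω
  have e2 : Set.EqOn f (fun _ => 1) {ω | N.active i ω = true}ᶜ := fun ω hω => if_neg hω
  rw [← lintegral_add_compl _ hm,
    setLIntegral_congr_fun hm e1, setLIntegral_congr_fun hm.compl e2, setLIntegral_const,
    setLIntegral_const, h3, N.prob_active, one_mul,
    ENNReal.ofReal_add (by linarith) (by positivity), ENNReal.ofReal_mul hp0.le, add_comm, mul_comm]

end PoissonBipolarNetwork

/-! ### Moments of products over Poisson counts -/

/-- The probability generating function of the Poisson law. -/
lemma lintegral_rpow_toReal_poissonMeasure (r : ℝ≥0) {z : ℝ} (hz : 0 ≤ z) :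
    ∫⁻ x, ENNReal.ofReal (z ^ x.toReal) ∂((poissonMeasure r).map (fun n : ℕ => (n : ℝ≥0∞))) =
      ENNReal.ofReal (Real.exp (-(r * (1 - z)))) := by
  have hm : Measurable fun x : ℝ≥0∞ => ENNReal.ofReal (z ^ x.toReal) := by fun_prop
  rw [lintegral_map hm (measurable_of_countable _), poissonMeasure, lintegral_sum_measure]
  simp only [lintegral_smul_measure, lintegral_dirac, ENNReal.toReal_natCast, Real.rpow_natCast,
    smul_eq_mul]
  have hs := (hasSum_one_poissonMeasure (r * z.toNNReal)).mul_left (Real.exp (-(r * (1 - z))))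
  rw [mul_one] at hs
  have h : ∀ n : ℕ, ENNReal.ofReal (Real.exp (-r) * r ^ n / n.factorial) * ENNReal.ofReal (z ^ n) =
      ENNReal.ofReal (Real.exp (-(r * (1 - z))) *
        (Real.exp (-(r * z.toNNReal : ℝ≥0)) * (r * z.toNNReal : ℝ≥0) ^ n / n.factorial)) := by
    intro n
    rw [← ENNReal.ofReal_mul (by positivity)]
    congr 1
    rw [NNReal.coe_mul, Real.coe_toNNReal _ hz, mul_div_assoc, mul_div_assoc, ← mul_assoc,
      ← Real.exp_add, show -(r * (1 - z)) + -(r * z) = -(r : ℝ) by ring, mul_pow]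
    ring
  simp_rw [h]
  rw [← ENNReal.ofReal_tsum_of_nonneg (fun n => by positivity) hs.summable, hs.tsum_eq]

lemma countingMeasure_apply {Ω : Type*} (X : ℕ → Ω → Plane) (ω : Ω) {A : Set Plane}
    (hA : MeasurableSet A) :
    countingMeasure X ω A = ({i | X i ω ∈ A} : Set ℕ).encard := by
  rw [countingMeasure, Measure.sum_apply _ hA, ← ENNReal.tsum_set_one,
    tsum_subtype {i | X i ω ∈ A} fun _ => (1 : ℝ≥0∞)]
  refine tsum_congr fun i => ?_
  rw [Measure.dirac_apply' _ hA]
  rfl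

lemma measurable_countingMeasure {Ω : Type*} [MeasurableSpace Ω] {X : ℕ → Ω → Plane}
    (hX : ∀ i, Measurable (X i)) : Measurable (countingMeasure X) := by
  refine Measure.measurable_of_measurable_coe _ fun A hA => ?_
  simp only [countingMeasure, Measure.sum_apply _ hA]
  refine Measurable.tsum fun i => ?_
  exact (Measure.measurable_coe hA).comp (Measure.measurable_dirac.comp (hX i))

/-- The product `∏ⱼ zⱼ ^ μ(Aⱼ)` of one factor `zⱼ` for each point of `μ` in the region `Aⱼ`. A region
of infinite mass contributes the factor `1`, since `∞.toReal = 0`; for `zⱼ ≤ 1` this keeps the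
product an upper bound. -/
noncomputable def regionProduct {n : ℕ} (A : Fin n → Set Plane) (z : Fin n → ℝ)
    (μ : Measure Plane) : ℝ := ∏ j, z j ^ (μ (A j)).toReal

lemma measurable_regionProduct {n : ℕ} {A : Fin n → Set Plane} (hA : ∀ j, MeasurableSet (A j))
    (z : Fin n → ℝ) : Measurable (regionProduct A z) :=
  Finset.measurable_prod _ fun j _ =>
    ((Measure.measurable_coe (hA j)).ennreal_toReal).const_pow (z j)

lemma regionProduct_nonneg {n : ℕ} {A : Fin n → Set Plane} {z : Fin n → ℝ} (hz : ∀ j, 0 ≤ z j)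
    (μ : Measure Plane) : 0 ≤ regionProduct A z μ :=
  Finset.prod_nonneg fun j _ => Real.rpow_nonneg (hz j) _

lemma regionProduct_le_one {n : ℕ} {A : Fin n → Set Plane} {z : Fin n → ℝ} (hz : ∀ j, 0 ≤ z j)
    (hz1 : ∀ j, z j ≤ 1) (μ : Measure Plane) : regionProduct A z μ ≤ 1 :=
  Finset.prod_le_one (fun j _ => Real.rpow_nonneg (hz j) _) fun j _ =>
    Real.rpow_le_one (hz j) (hz1 j) ENNReal.toReal_nonneg

lemma regionProduct_rpow {n : ℕ} {A : Fin n → Set Plane} {z : Fin n → ℝ} (hz : ∀ j, 0 ≤ z j)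
    (b : ℝ) (μ : Measure Plane) :
    regionProduct A z μ ^ b = regionProduct A (fun j => z j ^ b) μ := by
  unfold regionProduct
  rw [← Real.finsetProd_rpow _ _ fun j _ => Real.rpow_nonneg (hz j) _]
  refine Finset.prod_congr rfl fun j _ => ?_
  rw [← Real.rpow_mul (hz j), ← Real.rpow_mul (hz j), mul_comm]

lemma IsPoissonPointProcess.lintegral_regionProduct {Ω : Type*} [MeasurableSpace Ω] {P : Measure Ω}
    {X : ℕ → Ω → Plane} {lam : ℝ} (hX : IsPoissonPointProcess P X lam) (hlam : 0 ≤ lam) {n : ℕ}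
    {A : Fin n → Set Plane} (hA : ∀ j, MeasurableSet (A j)) (hAv : ∀ j, volume (A j) ≠ ∞)
    (hd : Pairwise fun j k => Disjoint (A j) (A k)) {z : Fin n → ℝ} (hz : ∀ j, 0 ≤ z j) :
    ∫⁻ ω, ENNReal.ofReal (regionProduct A z (countingMeasure X ω)) ∂P =
      ENNReal.ofReal (Real.exp (-(lam * ∑ j, volume.real (A j) * (1 - z j)))) := by
  have hm : ∀ j, Measurable fun x : ℝ≥0∞ => ENNReal.ofReal (z j ^ x.toReal) := fun j => by fun_prop
  have hc : ∀ j, Measurable fun ω => countingMeasure X ω (A j) := fun j =>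
    (Measure.measurable_coe (hA j)).comp (measurable_countingMeasure hX.measurable_points)
  have h := lintegral_prod_eq_prod_lintegral_of_indepFun Finset.univ
    (fun j ω => ENNReal.ofReal (z j ^ (countingMeasure X ω (A j)).toReal))
    ((hX.indep_count n A hA hd).comp _ hm) fun j => (hm j).comp (hc j)
  unfold regionProduct
  simp_rw [ENNReal.ofReal_prod_of_nonneg fun j (_ : j ∈ Finset.univ) =>
    Real.rpow_nonneg (hz j) _]
  rw [h, Finset.mul_sum, ← Finset.sum_neg_distrib, Real.exp_sum,
    ENNReal.ofReal_prod_of_nonneg fun j _ => (Real.exp_pos _).le]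
  refine Finset.prod_congr rfl fun j _ => ?_
  rw [← lintegral_map (hm j) (hc j), hX.map_count _ (hA j) (hAv j),
    lintegral_rpow_toReal_poissonMeasure _ (hz j), NNReal.coe_mul, Real.coe_toNNReal _ hlam,
    mul_assoc]
  rfl

/-! ### Bounding the conditional success probability and the meta distribution -/

namespace PoissonBipolarNetwork

variable {lam p : ℝ} (N : PoissonBipolarNetwork lam p)

/-- The signal-to-interference ratio as a deterministic function of the points `x` and of the marks
`m`, the pair of the activities and the gains. -/
noncomputable def sirOf (R α : ℝ) (x : ℕ → Plane) (m : (ℕ → Bool) × (Option ℕ → ℝ)) : ℝ≥0∞ :=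
  ENNReal.ofReal (m.2 none) * ENNReal.ofReal R ^ (-α) /
    ∑' i, if m.1 i = true then
      ENNReal.ofReal (m.2 (some i)) * ENNReal.ofReal ‖x i‖ ^ (-α) else 0

lemma measurable_sirOf (R α : ℝ) :
    Measurable fun q : (ℕ → Plane) × ((ℕ → Bool) × (Option ℕ → ℝ)) => sirOf R α q.1 q.2 := by
  unfold sirOf
  refine Measurable.div (by fun_prop) (Measurable.tsum fun i => ?_)
  refine Measurable.ite ?_ (by fun_prop) measurable_const
  exact measurableSet_eq_fun (by fun_prop) measurable_const

/-- Success probability for fixed interferer positions `x`. Each interferer in `A j` is heard at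
least as loudly as one at distance `ρ j`. Only the regions with finitely many points are used; the
others contribute the factor `1` to the right-hand side. -/
lemma measure_lt_sirOf_le_regionProduct (hp0 : 0 < p) (hp1 : p ≤ 1) {α θ : ℝ} (hα : 0 < α)
    (hθ : 0 < θ) {n : ℕ} {A : Fin n → Set Plane} (hA : ∀ j, MeasurableSet (A j))
    (hd : Pairwise fun j k => Disjoint (A j) (A k)) {ρ : Fin n → ℝ} (hρ : ∀ j, 0 < ρ j)
    (hAρ : ∀ j, ∀ x ∈ A j, ‖x‖ ≤ ρ j) (x : ℕ → Plane) :
    N.P {ω | ENNReal.ofReal θ <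
      sirOf 1 α x ((fun i => N.active i ω), fun j => N.gain j ω)} ≤
      ENNReal.ofReal (regionProduct A (fun j => 1 - p + p * (1 + θ * ρ j ^ (-α))⁻¹)
        (countingMeasure (fun i x => x i) x)) := by
  classical
  have hcount : ∀ j, countingMeasure (fun i x => x i) x (A j) =
      ({i | x i ∈ A j} : Set ℕ).encard := fun j => countingMeasure_apply _ _ (hA j)
  let J : Finset (Fin n) := Finset.univ.filter fun j => ({i | x i ∈ A j} : Set ℕ).Finite
  let T : Fin n → Finset ℕ := fun j =>
    if h : ({i | x i ∈ A j} : Set ℕ).Finite then h.toFinset else ∅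
  have hT : ∀ j i, i ∈ T j → x i ∈ A j := by
    intro j i hi
    by_cases h : ({i | x i ∈ A j} : Set ℕ).Finite
    · simpa [T, h] using hi
    · simp [T, h] at hi
  have hTd : (J : Set (Fin n)).PairwiseDisjoint T := by
    intro j _ k _ hjk
    refine Finset.disjoint_left.2 fun i hi hi' => ?_
    exact Set.disjoint_left.1 (hd hjk) (hT j i hi) (hT k i hi')
  let s := J.biUnion T
  -- the regions being disjoint, the sum has at most one nonzero term
  let c : ℕ → ℝ := fun i => ∑ j, if x i ∈ A j then θ * ρ j ^ (-α) else 0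
  have hc0 : ∀ i, 0 ≤ c i := fun i => Finset.sum_nonneg fun j _ => by
    have := hρ j
    split_ifs <;> positivity
  have hcj : ∀ j i, x i ∈ A j → c i = θ * ρ j ^ (-α) := by
    intro j i hi
    simp only [c]
    rw [Finset.sum_eq_single j, if_pos hi]
    · intro k _ hk
      exact if_neg fun hi' => Set.disjoint_left.1 (hd hk) hi' hi
    · simp
  have hprod : ∏ i ∈ s, ENNReal.ofReal (1 - p + p * (1 + c i)⁻¹) =
      ENNReal.ofReal (regionProduct A (fun j => 1 - p + p * (1 + θ * ρ j ^ (-α))⁻¹)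
        (countingMeasure (fun i x => x i) x)) := by
    have hz : ∀ j, 0 ≤ 1 - p + p * (1 + θ * ρ j ^ (-α))⁻¹ := fun j => by
      have := hρ j
      have : 0 ≤ 1 - p := by linarith
      positivity
    unfold regionProduct
    rw [ENNReal.ofReal_prod_of_nonneg fun j _ => Real.rpow_nonneg (hz j) _,
      Finset.prod_biUnion hTd]
    rw [← Finset.prod_subset (Finset.subset_univ J)]
    · refine Finset.prod_congr rfl fun j hj => ?_
      have hf : ({i | x i ∈ A j} : Set ℕ).Finite := by simpa [J] using hj
      rw [Finset.prod_congr rfl fun i hi => by rw [hcj j i (hT j i hi)], Finset.prod_const, hcount,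
        hf.encard_eq_coe_toFinset_card, ← ENNReal.ofReal_pow (hz j)]
      simp [T, hf]
    · intro j _ hj
      have hf : ({i | x i ∈ A j} : Set ℕ).Infinite := by simpa [J] using hj
      rw [hcount, hf.encard_eq]
      simp
  rw [← hprod]
  refine le_trans (measure_mono fun ω hω => ?_) (N.measure_active_gain_sum_lt_le hp0 hp1 s hc0)
  have h1 := ENNReal.mul_lt_of_lt_div hω
  simp only [ENNReal.ofReal_one, ENNReal.one_rpow, mul_one] at h1
  refine (ENNReal.ofReal_lt_ofReal_iff'.1 (lt_of_le_of_lt ?_ h1)).1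
  rw [ENNReal.ofReal_sum_of_nonneg]
  swap
  · intro i _
    split_ifs
    exacts [mul_nonneg (hc0 i) (le_max_right _ _), le_rfl]
  refine le_trans ?_ (mul_le_mul_right (ENNReal.sum_le_tsum s) _)
  rw [Finset.mul_sum]
  refine Finset.sum_le_sum fun i hi => ?_
  obtain ⟨j, _, hij⟩ := Finset.mem_biUnion.1 hi
  split_ifs with ha
  · rw [hcj j i (hT j i hij), ENNReal.ofReal_mul (by have := hρ j; positivity),
      ENNReal.ofReal_mul hθ.le, mul_assoc, mul_comm (ENNReal.ofReal (N.gain _ _)),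
      ENNReal.ofReal_max, ENNReal.ofReal_zero, max_eq_left zero_le,
      ← ENNReal.ofReal_rpow_of_pos (hρ j)]
    refine mul_le_mul_right (mul_le_mul_left ?_ _) _
    rw [ENNReal.rpow_neg, ENNReal.rpow_neg]
    have := hAρ j _ (hT j i hij)
    gcongr
  · simp

/-- Both sides are measurable with respect to `Φ`, so it suffices to compare their integrals over
events of the form `Φ ∈ B`. There the marks can be integrated out first, by their independence of
the points. -/
lemma linkSuccess_ae_le (hp0 : 0 < p) (hp1 : p ≤ 1) {α θ : ℝ} (hα : 0 < α)
    (hθ : 0 < θ) {n : ℕ} {A : Fin n → Set Plane} (hA : ∀ j, MeasurableSet (A j))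
    (hd : Pairwise fun j k => Disjoint (A j) (A k)) {ρ : Fin n → ℝ} (hρ : ∀ j, 0 < ρ j)
    (hAρ : ∀ j, ∀ x ∈ A j, ‖x‖ ≤ ρ j) :
    ∀ᵐ ω ∂N.P, N.linkSuccess 1 α θ ω ≤
      regionProduct A (fun j => 1 - p + p * (1 + θ * ρ j ^ (-α))⁻¹)
        (countingMeasure N.point ω) := by
  set z : Fin n → ℝ := fun j => 1 - p + p * (1 + θ * ρ j ^ (-α))⁻¹ with hzdef
  have hz0 : ∀ j, 0 ≤ z j := fun j => by
    have := hρ j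
    have : 0 ≤ 1 - p := by linarith
    simp only [z]; positivity
  have hz1 : ∀ j, z j ≤ 1 := fun j => by
    have := hρ j
    have : (1 + θ * ρ j ^ (-α))⁻¹ ≤ 1 := inv_le_one_of_one_le₀ (by
      have : 0 < θ * ρ j ^ (-α) := by positivity
      linarith)
    simp only [z]; nlinarith
  have hcm := measurable_countingMeasure N.isPoisson.measurable_points
  have hm : N.pointSigma ≤ N.mΩ := hcm.comap_le
  have hX : Measurable fun ω i => N.point i ω :=
    measurable_pi_lambda _ N.isPoisson.measurable_points
  have hY : Measurable fun ω => ((fun i => N.active i ω), (fun j => N.gain j ω)) :=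
    (measurable_pi_lambda _ N.measurable_active).prodMk
      (measurable_pi_lambda _ N.measurable_gain)
  set E : Set N.Ω := {ω | ENNReal.ofReal θ < N.sir 1 α ω} with hEdef
  have hE : MeasurableSet E :=
    measurableSet_lt measurable_const ((measurable_sirOf 1 α).comp (hX.prodMk hY))
  set G : N.Ω → ℝ := fun ω => regionProduct A z (countingMeasure N.point ω) with hGdef
  have hGm' : Measurable[N.pointSigma] G :=
    (measurable_regionProduct hA z).comp (comap_measurable _)
  have hGm : Measurable G := hGm'.mono hm le_rfl
  have hG0 : ∀ ω, 0 ≤ G ω := fun ω => regionProduct_nonneg hz0 _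
  have hGi : Integrable G N.P := by
    refine Integrable.of_bound hGm.aestronglyMeasurable 1 (.of_forall fun ω => ?_)
    rw [Real.norm_of_nonneg (hG0 ω)]
    exact regionProduct_le_one hz0 hz1 _
  have hEi : Integrable (E.indicator fun _ => (1 : ℝ)) N.P := (integrable_const 1).indicator hE
  have hle : ∀ S, MeasurableSet[N.pointSigma] S →
      ∫ ω in S, N.linkSuccess 1 α θ ω ∂N.P ≤ ∫ ω in S, G ω ∂N.P := by
    intro S hS
    have hS' : MeasurableSet S := hm _ hS
    rw [linkSuccess, setIntegral_condExp hm hEi hS]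
    change ∫ ω in S, E.indicator (1 : N.Ω → ℝ) ω ∂N.P ≤ _
    rw [integral_indicator_one hE]
    rw [← ENNReal.ofReal_le_ofReal_iff (integral_nonneg hG0),
      ofReal_integral_eq_lintegral_ofReal hGi.integrableOn (.of_forall hG0), ofReal_measureReal,
      Measure.restrict_apply hE]
    obtain ⟨B, hB, rfl⟩ := hS
    have hcm' : Measurable (countingMeasure fun i (x : ℕ → Plane) => x i) :=
      measurable_countingMeasure fun i => measurable_pi_apply i
    have hQ : MeasurableSet {q : (ℕ → Plane) × ((ℕ → Bool) × (Option ℕ → ℝ)) |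
        ENNReal.ofReal θ < sirOf 1 α q.1 q.2 ∧ countingMeasure (fun i x => x i) q.1 ∈ B} :=
      (measurableSet_lt measurable_const (measurable_sirOf 1 α)).inter
        ((hcm'.comp measurable_fst) hB)
    have key := N.indep_point_marks.measure_mem_eq_lintegral hX hY hQ
    refine (le_of_eq key).trans ?_
    rw [← lintegral_indicator hS']
    refine lintegral_mono fun ω => ?_
    by_cases hω : ω ∈ countingMeasure N.point ⁻¹' B
    · rw [Set.indicator_of_mem hω]
      refine le_trans (measure_mono fun ω' h => ?_)
        (N.measure_lt_sirOf_le_regionProduct hp0 hp1 hα hθ hA hd hρ hAρ fun i => N.point i ω)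
      exact h.1
    · rw [Set.indicator_of_notMem hω]
      refine (measure_mono_null (t := ∅) (fun ω' h => ?_) measure_empty).le
      exact hω h.2
  have hLm : StronglyMeasurable[N.pointSigma] (N.linkSuccess 1 α θ) := stronglyMeasurable_condExp
  refine ae_le_of_ae_le_trim (hm := hm) ?_
  refine ae_le_of_forall_setIntegral_le ?_ ?_ fun S hS _ => ?_
  · exact integrable_condExp.trim hm hLm
  · exact hGi.trim hm hGm'.stronglyMeasurable
  · rw [← setIntegral_trim hm hLm hS,
      ← setIntegral_trim hm hGm'.stronglyMeasurable hS]
    exact hle S hS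

/-- Markov's inequality for the `b`-th moment of the product bounding the success probability. -/
lemma eta_le_exp (hlam : 0 ≤ lam) (hp0 : 0 < p) (hp1 : p ≤ 1) {α θ ε b : ℝ} (hα : 0 < α)
    (hθ : 0 < θ) (hε : ε < 1) (hb : 0 < b) {n : ℕ} {A : Fin n → Set Plane}
    (hA : ∀ j, MeasurableSet (A j)) (hAv : ∀ j, volume (A j) ≠ ∞)
    (hd : Pairwise fun j k => Disjoint (A j) (A k)) {ρ : Fin n → ℝ} (hρ : ∀ j, 0 < ρ j)
    (hAρ : ∀ j, ∀ x ∈ A j, ‖x‖ ≤ ρ j) :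
    N.eta 1 α θ ε ≤ ENNReal.ofReal (Real.exp (-(lam * ∑ j, volume.real (A j) *
      (1 - (1 - p + p * (1 + θ * ρ j ^ (-α))⁻¹) ^ b))) / (1 - ε) ^ b) := by
  have hz0 : ∀ j, 0 ≤ 1 - p + p * (1 + θ * ρ j ^ (-α))⁻¹ := fun j => by
    have := hρ j
    have : 0 ≤ 1 - p := by linarith
    positivity
  have hε' : 0 < 1 - ε := by linarith
  have hεb : 0 < (1 - ε) ^ b := by positivity
  have hG := N.isPoisson.lintegral_regionProduct hlam hA hAv hd
    fun j => Real.rpow_nonneg (hz0 j) b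
  have hm : Measurable fun ω => ENNReal.ofReal (regionProduct A
      (fun j => (1 - p + p * (1 + θ * ρ j ^ (-α))⁻¹) ^ b) (countingMeasure N.point ω)) :=
    ((measurable_regionProduct hA _).comp
      (measurable_countingMeasure N.isPoisson.measurable_points)).ennreal_ofReal
  rw [ENNReal.ofReal_div_of_pos hεb, ← hG]
  refine le_trans ?_ (meas_ge_le_lintegral_div hm.aemeasurable (by simpa using hεb)
    ENNReal.ofReal_ne_top)
  refine measure_mono_ae ?_
  filter_upwards [N.linkSuccess_ae_le hp0 hp1 hα hθ hA hd hρ hAρ] with ω hω h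
  change ENNReal.ofReal _ ≤ ENNReal.ofReal _
  rw [← regionProduct_rpow hz0]
  have h' : 1 - ε < N.linkSuccess 1 α θ ω := h
  exact ENNReal.ofReal_le_ofReal (Real.rpow_le_rpow hε'.le (h'.le.trans hω) hb.le)

end PoissonBipolarNetwork

/-! ### Annuli and the capacity bound -/

/-- The annulus of points whose squared distance to the origin lies in `(s, t]`. In this
parametrization the area is linear. -/
def annulus (s t : ℝ) : Set Plane := {x | s < ‖x‖ ^ 2 ∧ ‖x‖ ^ 2 ≤ t}

lemma measurableSet_annulus (s t : ℝ) : MeasurableSet (annulus s t) := by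
  have h : Measurable fun x : Plane => ‖x‖ ^ 2 := by fun_prop
  exact (measurableSet_lt measurable_const h).inter (measurableSet_le h measurable_const)

lemma volume_annulus {s t : ℝ} (hs : 0 ≤ s) (hst : s ≤ t) :
    volume (annulus s t) = ENNReal.ofReal (Real.pi * (t - s)) := by
  have hball : ∀ r : ℝ, 0 ≤ r → ∀ x : Plane, x ∈ Metric.closedBall 0 (√r) ↔ ‖x‖ ^ 2 ≤ r := by
    intro r hr x
    rw [mem_closedBall_zero_iff, Real.le_sqrt (norm_nonneg x) hr]
  have hvol : ∀ r : ℝ, 0 ≤ r →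
      volume (Metric.closedBall (0 : Plane) (√r)) = ENNReal.ofReal (Real.pi * r) := by
    intro r hr
    rw [EuclideanSpace.volume_closedBall_fin_two, ← ENNReal.ofReal_pow (Real.sqrt_nonneg r),
      Real.sq_sqrt hr, mul_comm, ENNReal.ofReal_mul Real.pi_pos.le]
  have h : annulus s t = Metric.closedBall 0 (√t) \ Metric.closedBall 0 (√s) := by
    ext x
    rw [Set.mem_sdiff, hball t (hs.trans hst), hball s hs, not_le, and_comm]
    rfl
  rw [h, measure_sdiff (Metric.closedBall_subset_closedBall (Real.sqrt_le_sqrt hst))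
    Metric.isClosed_closedBall.measurableSet.nullMeasurableSet (by rw [hvol s hs]; simp),
    hvol t (hs.trans hst), hvol s hs, ← ENNReal.ofReal_sub _ (by positivity), mul_sub]

lemma disjoint_annulus_nat_div (m : ℕ) {i j : ℕ} (hij : i ≠ j) :
    Disjoint (annulus (i / m) ((i + 1) / m)) (annulus (j / m) ((j + 1) / m)) := by
  wlog h : i < j generalizing i j
  · exact (this hij.symm (lt_of_le_of_ne (not_lt.1 h) hij.symm)).symm
  refine Set.disjoint_left.2 fun x hx hx' => ?_
  have h1 : ((i : ℝ) + 1) / m ≤ j / m := by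
    gcongr; exact_mod_cast h
  exact absurd (hx.2.trans h1) (not_le.2 hx'.1)

lemma mul_exp_neg_mul_le {x c : ℝ} (hc : 0 < c) :
    x * Real.exp (-(x * c)) ≤ 1 / (Real.exp 1 * c) := by
  have h := Real.add_one_le_exp (x * c - 1)
  rw [Real.exp_sub, le_div_iff₀ (Real.exp_pos 1)] at h
  rw [Real.exp_neg, ← div_eq_mul_inv, div_le_div_iff₀ (Real.exp_pos _) (by positivity)]
  nlinarith

/-- The bound for one network and any decreasing integrable `f` that minorizes the Laplace exponent
density per unit of `p`; the right-hand side depends on neither `lam` nor `p`. -/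
lemma PoissonBipolarNetwork.mul_eta_le {lam p : ℝ} (N : PoissonBipolarNetwork lam p)
    (hlam : 0 < lam) (hp0 : 0 < p) (hp1 : p ≤ 1) {α δ θ ε b : ℝ} (hα : 2 < α) (hδ : δ = 2 / α)
    (hθ : 0 < θ) (hε : ε < 1) (hb : 0 < b) {f : ℝ → ℝ} (hf : AntitoneOn f (Set.Ioi 0))
    (hfi : IntegrableOn f (Set.Ioi 0)) (hf0 : 0 < ∫ t in Set.Ioi 0, f t)
    (hfp : ∀ t, 0 < t → p * f t ≤ 1 - (1 - p + p * fadeLaplace δ θ t) ^ b) :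
    ENNReal.ofReal (lam * p) * N.eta 1 α θ ε ≤ ENNReal.ofReal
      (1 / (Real.exp 1 * (Real.pi * ∫ t in Set.Ioi 0, f t)) / (1 - ε) ^ b) := by
  have hεb : 0 < (1 - ε) ^ b := Real.rpow_pos_of_pos (by linarith) b
  have hlim := tendsto_intervalIntegral_riemann_window hfi
  set I : ℕ → ℝ := fun n => ∫ t in (1 / (n + 1 : ℕ) : ℝ)..(1 / (n + 1 : ℕ) + (n + 1 : ℕ)), f t
  have hlim2 := ENNReal.tendsto_ofReal (((tendsto_const_nhds (x := (1 : ℝ))).div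
    ((hlim.const_mul Real.pi).const_mul (Real.exp 1)) (by positivity)).div_const ((1 - ε) ^ b))
  refine ge_of_tendsto hlim2 ?_
  filter_upwards [hlim.eventually_const_lt hf0] with n hn
  have hm : 0 < n + 1 := n.succ_pos
  have hsum := hf.integral_le_riemann_sum hm
  set m := n + 1
  have hm' : (0 : ℝ) < m := by exact_mod_cast hm
  have hvol : ∀ j : ℕ, volume (annulus (j / m) ((j + 1) / m)) = ENNReal.ofReal (Real.pi * (1 / m)) := by
    intro j
    rw [volume_annulus (by positivity) (by gcongr; linarith)]
    congr 2; ring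
  have heta := N.eta_le_exp hlam.le hp0 hp1 (α := α) (by linarith) hθ hε hb (n := m ^ 2)
    (A := fun j => annulus (j / m) ((j + 1) / m)) (fun j => measurableSet_annulus _ _)
    (fun j => by rw [hvol]; exact ENNReal.ofReal_ne_top)
    (fun i j hij => disjoint_annulus_nat_div m fun h => hij (Fin.ext h))
    (ρ := fun j => √((j + 1) / m)) (fun j => by positivity)
    (fun j x hx => Real.le_sqrt_of_sq_le hx.2)
  have hρ : ∀ j : ℕ, (1 + θ * √(((j : ℝ) + 1) / m) ^ (-α))⁻¹ = fadeLaplace δ θ ((j + 1) / m) := by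
    intro j
    rw [fadeLaplace, Real.sqrt_eq_rpow, ← Real.rpow_mul (by positivity), hδ]
    congr 4
    field_simp
  -- on the cell `j` the factor is evaluated at the outer rim `(j + 1) / m`: a lower Riemann sum
  have hlow : p * (Real.pi * I n) ≤ ∑ j : Fin (m ^ 2),
      volume.real (annulus (j / m) ((j + 1) / m)) *
      (1 - (1 - p + p * (1 + θ * √(((j : ℝ) + 1) / m) ^ (-α))⁻¹) ^ b) := by
    simp only [measureReal_def, hvol, hρ]
    rw [Fin.sum_univ_eq_sum_range (fun j => (ENNReal.ofReal (Real.pi * (1 / m))).toReal *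
      (1 - (1 - p + p * fadeLaplace δ θ (((j : ℝ) + 1) / m)) ^ b)),
      ENNReal.toReal_ofReal (by positivity)]
    calc p * (Real.pi * I n)
        ≤ p * (Real.pi * ∑ i ∈ Finset.range (m ^ 2), (1 / m : ℝ) * f ((i + 1) / m)) := by
          gcongr
      _ = ∑ i ∈ Finset.range (m ^ 2), Real.pi * (1 / m) * (p * f ((i + 1) / m)) := by
          simp only [Finset.mul_sum]
          exact Finset.sum_congr rfl fun i _ => by ring
      _ ≤ _ := by
          refine Finset.sum_le_sum fun i _ => ?_
          exact mul_le_mul_of_nonneg_left (hfp _ (by positivity)) (by positivity)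
  refine (mul_le_mul_right heta _).trans ?_
  rw [← ENNReal.ofReal_mul (by positivity), ← mul_div_assoc]
  refine ENNReal.ofReal_le_ofReal (div_le_div_of_nonneg_right ?_ hεb.le)
  refine le_trans ?_ (mul_exp_neg_mul_le (x := lam * p) (by positivity))
  refine mul_le_mul_of_nonneg_left (Real.exp_le_exp.2 (neg_le_neg ?_)) (by positivity)
  rw [mul_assoc]
  exact mul_le_mul_of_nonneg_left hlow hlam.le

lemma spatialOutageCapacity_le
    (N : ∀ lam p : ℝ, 0 < lam → 0 < p → p ≤ 1 → PoissonBipolarNetwork lam p)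
    {α δ θ ε b : ℝ} (hα : 2 < α) (hδ : δ = 2 / α)
    (hθ : 0 < θ) (hε : ε < 1) (hb : 0 < b) {f : ℝ → ℝ} (hf : AntitoneOn f (Set.Ioi 0))
    (hfi : IntegrableOn f (Set.Ioi 0)) (hf0 : 0 < ∫ t in Set.Ioi 0, f t)
    (hfp : ∀ p t, 0 < p → p ≤ 1 → 0 < t →
      p * f t ≤ 1 - (1 - p + p * fadeLaplace δ θ t) ^ b) :
    spatialOutageCapacity N 1 α θ ε ≤ ENNReal.ofReal
      (1 / (Real.exp 1 * (Real.pi * ∫ t in Set.Ioi 0, f t)) / (1 - ε) ^ b) :=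
  iSup_le fun lam => iSup_le fun p => iSup_le fun hlam => iSup_le fun hp0 => iSup_le fun hp1 =>
    (N lam p hlam hp0 hp1).mul_eta_le hlam hp0 hp1 hα hδ hθ hε hb hf hfi hf0
      fun t ht => hfp p t hp0 hp1 ht

theorem mainTheorem4
    (N : ∀ lam p : ℝ, 0 < lam → 0 < p → p ≤ 1 → PoissonBipolarNetwork lam p)
    (α δ θ ε b : ℝ) (hα : 2 < α) (hδ : δ = 2 / α) (hθ : 0 < θ)
    (hε0 : 0 < ε) (hε1 : ε < 1) (hb : 0 < b) :
    (b ≤ 1 → spatialOutageCapacity N 1 α θ ε ≤ ENNReal.ofReal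
      (1 / (Real.exp 1 * Real.pi * θ ^ δ * Real.Gamma (1 - δ) * Real.Gamma (1 + δ))
        * (1 / (b * (1 - ε) ^ b)))) ∧
    (1 < b → spatialOutageCapacity N 1 α θ ε ≤ ENNReal.ofReal
      (1 / (Real.exp 1 * Real.pi * θ ^ δ * Real.Gamma (1 - δ))
        * (Real.Gamma b / (Real.Gamma (b + δ) * (1 - ε) ^ b)))) := by
  have hδ0 : 0 < δ := by rw [hδ]; positivity
  have hδ1 : δ < 1 := by rw [hδ, div_lt_one (by linarith)]; exact hα
  have hΓ1 := Real.Gamma_pos_of_pos (show 0 < 1 - δ by linarith)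
  have hw0 := fun {t : ℝ} (ht : 0 < t) => fadeLaplace_pos (δ := δ) hθ ht
  have hw1 := fun {t : ℝ} (ht : 0 < t) => fadeLaplace_lt_one (δ := δ) hθ ht
  have hmono := fadeLaplace_monotoneOn hδ0 hθ
  constructor
  · intro hb1
    have hΓ2 := Real.Gamma_pos_of_pos (show 0 < 1 + δ by linarith)
    obtain ⟨hi, hI⟩ := integral_one_sub_fadeLaplace_rpow hδ0 hδ1 hθ one_pos
    simp only [Real.rpow_one, Real.Gamma_one, div_one] at hi hI
    have h := spatialOutageCapacity_le N hα hδ hθ hε1 hb (f := fun t => b * (1 - fadeLaplace δ θ t))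
      (fun s hs t ht hst => by have := hmono hs ht hst; simp only; gcongr) (hi.const_mul b)
      (by rw [integral_const_mul, hI]; positivity) ?_
    · rw [integral_const_mul, hI] at h
      refine h.trans_eq (congrArg _ ?_)
      field_simp
    · intro p t hp0 hp1 ht
      -- Bernoulli's inequality, as `b ≤ 1`
      have := rpow_one_add_le_one_add_mul_self (s := -(p * (1 - fadeLaplace δ θ t)))
        (by nlinarith [hw0 ht, hw1 ht]) hb.le hb1
      rw [show 1 - p + p * fadeLaplace δ θ t = 1 + -(p * (1 - fadeLaplace δ θ t)) by ring]
      linarith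
  · intro hb1
    have hΓb := Real.Gamma_pos_of_pos hb
    have hΓ2 := Real.Gamma_pos_of_pos (show 0 < b + δ by linarith)
    obtain ⟨hi, hI⟩ := integral_one_sub_fadeLaplace_rpow hδ0 hδ1 hθ hb
    have h := spatialOutageCapacity_le N hα hδ hθ hε1 hb (f := fun t => 1 - fadeLaplace δ θ t ^ b)
      (fun s hs t ht hst => by
        have := hmono hs ht hst
        have := (hw0 hs).le
        simp only; gcongr) hi
      (by rw [hI]; positivity) ?_
    · rw [hI] at h
      refine h.trans_eq (congrArg _ ?_)
      field_simp
    · intro p t hp0 hp1 ht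
      -- convexity of `x ^ b` between `1` and `w`
      have := (convexOn_rpow hb1.le).2 (Set.mem_Ici.2 zero_le_one) (Set.mem_Ici.2 (hw0 ht).le)
        (show 0 ≤ 1 - p by linarith) hp0.le (by ring)
      simp only [smul_eq_mul, mul_one, Real.one_rpow] at this
      linarith
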